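/- Let $M$ be a closed manifold, i.e. a compact connected smooth manifold without boundary endowed with a Riemannian metric $\|\cdot\|$, and let $d$ be the induced distance. Let $V$ be a $C^1$ vector field on $M$, let $V_t(x)$ $(t\in\mathbb R)$ denote the solution of $\dot x=V(x)$ with initial condition $x$, and write $V_{[a,b]}(x)=\{V_t(x):a\le t\le b\}$. Let $\mathrm{Sing}(V)=\{x\in M: V(x)=0\}$, and for $z\in M$ and $A\subset M$ let $\mathrm{dist}(z,A)=\inf_{a\in A}d(z,a)$ if $A\ne\emptyset$ and $\mathrm{dist}(z,\emptyset)=\mathrm{diam}(M)$. Let $\Lambda\subset M$ be any subset. $V$ is *singular-expansive on $\Lambda$* if for every $\epsilon>0$ there is $\delta>0$ such that whenever $x,y\in\Lambda$ and an increasing homeomorphism $s:\mathbb R\to\mathbb R$ satisfy $d(V_t(x),V_{s(t)}(y))\le\delta\,\mathrm{dist}(V_t(x),\mathrm{Sing}(V))$ for every $t\in\mathbb R$, then $V_{s(t_0)}(y)\in V_{[t_0-\epsilon,t_0+\epsilon]}(x)$ for some $t_0\in\mathbb R$. $V$ is *rescaling expansive on $\Lambda$* if for every $\epsilon>0$ there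 is $\delta>0$ such that whenever $x,y\in\Lambda$ and an increasing homeomorphism $s:\mathbb R\to\mathbb R$ satisfy $d(V_t(x),V_{s(t)}(y))\le\delta\,\|V(V_t(x))\|$ for every $t\in\mathbb R$, then $V_{s(0)}(y)\in V_{[-\epsilon,\epsilon]}(x)$. **Theorem.** Suppose that the derivative $DV(\sigma):T_\sigma M\to T_\sigma M$ is invertible for every $\sigma\in\mathrm{Sing}(V)$. Then, for every subset $\Lambda\subset M$, $V$ is singular-expansive on $\Lambda$ if and only if $V$ is rescaling expansive on $\Lambda$. -/

import Mathlib

open Set Bundle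
open scoped Manifold ContDiff

namespace SingularFlow

noncomputable section

section Metric

variable {X : Type*} [MetricSpace X]

open Classical in
/-- The distance `dist(z, A) = inf {d(z, a) : a ∈ A}` from a point to a set, with the convention
`dist(z, ∅) = diam X`. -/
def distTo (z : X) (A : Set X) : ℝ :=
  if A.Nonempty then Metric.infDist z A else Metric.diam (Set.univ : Set X)

end Metric

section Manifold

variable {E : Type*} [NormedAddCommGroup E] [NormedSpace ℝ E]
  {H : Type*} [TopologicalSpace H] {I : ModelWithCorners ℝ E H}
  {M : Type*} [TopologicalSpace M] [ChartedSpace H M]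

open Classical in
/-- `flow V t x` is `V_t(x)`, the value at time `t` of the solution of `ẋ = V(x)` starting at `x`.
For a `C^1` vector field on a compact manifold without boundary the solution exists for all times
and is unique, so that the `else` branch is never taken and the choice is the only possible one. -/
def flow (V : (x : M) → TangentSpace I x) (t : ℝ) (x : M) : M :=
  if h : ∃ γ : ℝ → M, γ 0 = x ∧ IsMIntegralCurve γ V then Classical.choose h t else x

/-- The singular set: the zeros of `V`. -/
def Sing (V : (x : M) → TangentSpace I x) : Set M := {x | V x = 0}

/-- The derivative `DV(σ)` of the vector field `V` at `σ`, in the local coordinates around `σ`: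
`V` is read in the local trivialization of the tangent bundle given by the preferred chart at `σ`
(which is the identity on the tangent space at `σ`) and the resulting `E`-valued function is
differentiated at `σ`. At a singularity `σ` this endomorphism of the tangent space at `σ` does not
depend on the coordinates. -/
def derivAt [IsManifold I 1 M] (V : (x : M) → TangentSpace I x) (σ : M) :
    TangentSpace I σ →L[ℝ] TangentSpace I σ :=
  mfderiv I 𝓘(ℝ, E)
    (fun x : M => (trivializationAt E (TangentSpace I : M → Type _) σ
      (⟨x, V x⟩ : TangentBundle I M)).2) σ

end Manifold

section Expansivity

variable {E : Type*} [NormedAddCommGroup E] [NormedSpace ℝ E]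
  {H : Type*} [TopologicalSpace H] {I : ModelWithCorners ℝ E H}
  {M : Type*} [MetricSpace M] [ChartedSpace H M]

/-- `V` is singular-expansive on `Λ`. -/
def SingularExpansiveOn (V : (x : M) → TangentSpace I x) (Λ : Set M) : Prop :=
  ∀ ε : ℝ, 0 < ε → ∃ δ : ℝ, 0 < δ ∧ ∀ x ∈ Λ, ∀ y ∈ Λ, ∀ s : ℝ ≃ₜ ℝ, StrictMono s →
    (∀ t : ℝ, dist (flow V t x) (flow V (s t) y) ≤ δ * distTo (flow V t x) (Sing V)) →
    ∃ t₀ : ℝ, flow V (s t₀) y ∈ (fun t : ℝ => flow V t x) '' Icc (t₀ - ε) (t₀ + ε)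

/-- `V` is rescaling expansive on `Λ`; the norm is the Riemannian one. -/
def RescalingExpansiveOn [RiemannianBundle (fun x : M => TangentSpace I x)]
    (V : (x : M) → TangentSpace I x) (Λ : Set M) : Prop :=
  ∀ ε : ℝ, 0 < ε → ∃ δ : ℝ, 0 < δ ∧ ∀ x ∈ Λ, ∀ y ∈ Λ, ∀ s : ℝ ≃ₜ ℝ, StrictMono s →
    (∀ t : ℝ, dist (flow V t x) (flow V (s t) y) ≤ δ * ‖V (flow V t x)‖) →
    flow V (s 0) y ∈ (fun t : ℝ => flow V t x) '' Icc (-ε) ε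

end Expansivity

end

end SingularFlow

/-! Nondegeneracy makes `‖V x‖` comparable with `distTo x (Sing V)`. At a zero `σ` the derivative is
bounded below, so `‖V x‖` is of the order of `dist x σ`, and in particular `σ` is an isolated zero.
Near a regular point both quantities lie between positive constants. Compactness makes the constant
global (`exists_norm_comparable_distTo`), so the two shadowing hypotheses agree up to rescaling `δ`.

Rescaling expansivity then gives singular expansivity with `t₀ = 0`. Conversely, singular
expansivity controls only one time `t₀`, and the control has to be carried to time `0`. It puts `y`
on the orbit of `x`, so `s` becomes a time change `h` of that orbit with `h t₀` close to `t₀`. By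
`exists_le_dist_flow`, for short times the flow moves `z` by at least `c * (|t| * ‖V z‖)`. With `δ <
c * e`, shadowing excludes `|h t - t| = e`, and continuity keeps `|h t - t| < e` for all `t`
(`abs_sub_lt_of_dist_flow_le`). -/

namespace SingularFlow

open Filter Topology

/-! ### Short-time displacement for differential equations in a normed space. -/

section ODE

variable {E : Type*} [NormedAddCommGroup E] [NormedSpace ℝ E]

/-- An integral curve of a `K`-Lipschitz vector field moves away from its initial point with
at least half its initial speed, for times at most `1 / (4 * K)`. -/
lemma abs_mul_norm_le_of_lipschitzOnWith {f : E → E} {α : ℝ → E} {K : NNReal} {ε : ℝ} {s : Set E}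
    (hf : LipschitzOnWith K f s) (hα : ∀ t ∈ Ioo (-ε) ε, HasDerivAt α (f (α t)) t)
    (hs : ∀ t ∈ Ioo (-ε) ε, α t ∈ s) (hε : K * ε ≤ 1 / 4) {u : ℝ} (hu : u ∈ Ioo (-ε) ε) :
    |u| * ‖f (α 0)‖ ≤ 2 * ‖α u - α 0‖ := by
  have h0 : (0 : ℝ) ∈ Ioo (-ε) ε := by
    constructor <;> linarith [hu.1, hu.2]
  have hsub : uIcc 0 u ⊆ Ioo (-ε) ε := ordConnected_Ioo.uIcc_subset h0 hu
  have hcont : ContinuousOn (fun t => ‖α t - α 0‖) (uIcc 0 u) := fun t ht =>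
    ((hα t (hsub ht)).continuousAt.sub continuousAt_const).norm.continuousWithinAt
  -- Let `S` be the largest displacement up to time `u`. The velocity varies by at most `K * S`, so
  -- `S ≤ |u| * ‖f (α 0)‖ + S / 4`, while `α u - α 0` differs from `u • f (α 0)` by at most `S / 4`.
  -- Eliminating `S` gives the bound.
  obtain ⟨τ, hτ, hmax⟩ := isCompact_uIcc.exists_isMaxOn nonempty_uIcc hcont
  set S := ‖α τ - α 0‖ with hS
  have hS0 : 0 ≤ S := norm_nonneg _
  have hdiff : ∀ t ∈ uIcc 0 u, ‖f (α t) - f (α 0)‖ ≤ K * S := fun t ht =>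
    (hf.norm_sub_le (hs t (hsub ht)) (hs 0 h0)).trans
      (mul_le_mul_of_nonneg_left (hmax ht) K.2)
  have hK : K * |u| ≤ 1 / 4 :=
    (mul_le_mul_of_nonneg_left (abs_lt.2 ⟨hu.1, hu.2⟩).le K.2).trans hε
  have hτu : |τ| ≤ |u| := by simpa using abs_sub_left_of_mem_uIcc hτ
  have h1 : S ≤ (‖f (α 0)‖ + K * S) * ‖τ - 0‖ :=
    (convex_uIcc 0 u).norm_image_sub_le_of_norm_hasDerivWithin_le
      (fun t ht => (hα t (hsub ht)).hasDerivWithinAt)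
      (fun t ht => by
        have := norm_le_norm_add_norm_sub' (f (α t)) (f (α 0))
        linarith [hdiff t ht]) left_mem_uIcc hτ
  have h2 : ‖(α u - u • f (α 0)) - (α 0 - (0 : ℝ) • f (α 0))‖ ≤ (K * S) * ‖u - 0‖ :=
    (convex_uIcc 0 u).norm_image_sub_le_of_norm_hasDerivWithin_le
      (f := fun t => α t - t • f (α 0)) (f' := fun t => f (α t) - f (α 0))
      (fun t ht => by
        have := ((hα t (hsub ht)).sub ((hasDerivAt_id t).smul_const (f (α 0)))).hasDerivWithinAt
          (s := uIcc 0 u)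
        rw [one_smul] at this
        exact this)
      hdiff left_mem_uIcc right_mem_uIcc
  rw [sub_zero, Real.norm_eq_abs] at h1 h2
  have h3 : S ≤ |u| * ‖f (α 0)‖ + 1 / 4 * S := by
    have : (‖f (α 0)‖ + K * S) * |τ| ≤ (‖f (α 0)‖ + K * S) * |u| := by gcongr
    nlinarith [mul_le_mul_of_nonneg_right hK hS0]
  have h4 : ‖u • f (α 0)‖ ≤ ‖α u - α 0‖ + ‖(α u - u • f (α 0)) - (α 0 - (0 : ℝ) • f (α 0))‖ := by
    have : u • f (α 0) =
      (α u - α 0) - ((α u - u • f (α 0)) - (α 0 - (0 : ℝ) • f (α 0))) := by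
      rw [zero_smul]; abel
    conv_lhs => rw [this]
    exact norm_sub_le _ _
  rw [norm_smul, Real.norm_eq_abs] at h4
  nlinarith [mul_le_mul_of_nonneg_right hK hS0]

/-- Local solutions of a `C¹` autonomous differential equation: they exist for a uniform time,
stay in a prescribed neighbourhood, and leave their initial point at least at half speed. -/
lemma exists_local_flow_of_contDiffAt [CompleteSpace E] {f : E → E} {x₀ : E}
    (hf : ContDiffAt ℝ 1 f x₀) {s : Set E} (hs : s ∈ 𝓝 x₀) :
    ∃ r > 0, ∃ ε > 0, ∀ x ∈ Metric.closedBall x₀ r, ∃ α : ℝ → E, α 0 = x ∧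
      ∀ t ∈ Ioo (-ε) ε, HasDerivAt α (f (α t)) t ∧ α t ∈ s ∧
        |t| * ‖f x‖ ≤ 2 * ‖α t - x‖ := by
  obtain ⟨ε, hε, a, r, L, K, hr, hpl⟩ := IsPicardLindelof.of_contDiffAt_one hf
  obtain ⟨b, hb, hbs⟩ := Metric.nhds_basis_closedBall.mem_iff.1 hs
  have ha : 0 < a := by
    have h := (hpl 0).mul_max_le
    have h' : (0 : ℝ) ≤ L * max (0 + ε - 0) (0 - (0 - ε)) := by
      have : 0 ≤ max (0 + ε - 0) (0 - (0 - ε)) := le_max_of_le_left (by linarith)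
      positivity
    have hr' : (0 : ℝ) < r := hr
    exact_mod_cast (by simp only at h; linarith : (0 : ℝ) < a)
  lift b to NNReal using hb.le
  have hb' : 0 < b := by exact_mod_cast hb
  have hab : 0 < min a b := lt_min ha hb'
  -- Radius `min a b` confines the solutions to `s`; half of it is left for the initial points. In
  -- the time bound below, `K + 1` replaces `K` because `K` may vanish.
  obtain ⟨η, hη, hpl'⟩ := IsPicardLindelof.exists_shrink_radius hε (hpl 0)
    (a' := min a b) (r' := min a b / 2) (min_le_left _ _) (NNReal.half_lt_self hab.ne')
  refine ⟨(min a b / 2 : NNReal), by positivity, min η (1 / (4 * (K + 1))), by positivity,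
    fun x hx => ?_⟩
  obtain ⟨α, hα⟩ := ODE.FunSpace.exists_isFixedPt_next hpl' hx
  have hball : ∀ t, α.compProj t ∈ Metric.closedBall x₀ ((min a b : NNReal) : ℝ) :=
    fun t => α.compProj_mem_closedBall hpl'.mul_max_le
  have h0 : α.compProj 0 = x := by
    have h : α.compProj ((⟨0, by constructor <;> linarith⟩ : Icc (0 - η) (0 + η)) : ℝ) = x := by
      rw [ODE.FunSpace.compProj_val, ← hα, ODE.FunSpace.next_apply₀]
    exact h
  have hder : ∀ t ∈ Ioo (-(min η (1 / (4 * (K + 1) : ℝ)))) (min η (1 / (4 * (K + 1)))),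
      HasDerivAt α.compProj (f (α.compProj t)) t := by
    intro t ht
    have h1 : 0 - η < t := by linarith [ht.1, min_le_left η (1 / (4 * (K + 1) : ℝ))]
    have h2 : t < 0 + η := by linarith [ht.2, min_le_left η (1 / (4 * (K + 1) : ℝ))]
    have : HasDerivWithinAt α.compProj (f (α.compProj t)) (Icc (0 - η) (0 + η)) t := by
      apply (ODE.hasDerivWithinAt_picard_Icc (t₀ := 0) (by constructor <;> linarith)
        hpl'.continuousOn_uncurry α.continuous_compProj.continuousOn
        (fun _ _ => hball _) x ⟨h1.le, h2.le⟩).congr_of_mem _ ⟨h1.le, h2.le⟩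
      intro t' ht'
      rw [ODE.FunSpace.compProj_of_mem ht']
      conv_lhs => rw [← hα]
      rw [ODE.FunSpace.next_apply]
    exact this.hasDerivAt (Icc_mem_nhds h1 h2)
  refine ⟨α.compProj, h0, fun t ht => ⟨hder t ht, hbs ?_, ?_⟩⟩
  · exact Metric.closedBall_subset_closedBall (by exact_mod_cast min_le_right a b) (hball t)
  · have hK : (K : ℝ) * min η (1 / (4 * (K + 1))) ≤ 1 / 4 := by
      calc (K : ℝ) * min η (1 / (4 * (K + 1))) ≤ (K + 1) * (1 / (4 * (K + 1))) := by
            gcongr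
            · linarith
            · exact min_le_right _ _
        _ = 1 / 4 := by field_simp
    have := abs_mul_norm_le_of_lipschitzOnWith
      (hpl'.lipschitzOnWith 0 (by constructor <;> linarith)) hder (fun t _ => hball t) hK ht
    rwa [h0] at this

end ODE

end SingularFlow

namespace SingularFlow

open Filter Topology

/-! ### The vector field in local coordinates. -/

section Local

variable
    {E : Type*} [NormedAddCommGroup E] [NormedSpace ℝ E]
    {M : Type*} [MetricSpace M]
    [ChartedSpace E M] [IsManifold 𝓘(ℝ, E) 1 M]

/-- The vector field `V` read in the trivialization of the tangent bundle around `p`. -/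
noncomputable def coordField (V : (x : M) → TangentSpace 𝓘(ℝ, E) x) (p x : M) : E :=
  (trivializationAt E (TangentSpace 𝓘(ℝ, E) : M → Type _) p
      (⟨x, V x⟩ : TangentBundle 𝓘(ℝ, E) M)).2

variable {V : (x : M) → TangentSpace 𝓘(ℝ, E) x}

lemma contMDiffAt_coordField
    (hV : ContMDiff 𝓘(ℝ, E) 𝓘(ℝ, E).tangent 1
      (fun x : M => (⟨x, V x⟩ : TangentBundle 𝓘(ℝ, E) M))) (p : M) :
    ContMDiffAt 𝓘(ℝ, E) 𝓘(ℝ, E) 1 (coordField V p) p :=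
  (Bundle.contMDiffAt_section p).1 (hV p)

lemma contDiffAt_coordField
    (hV : ContMDiff 𝓘(ℝ, E) 𝓘(ℝ, E).tangent 1
      (fun x : M => (⟨x, V x⟩ : TangentBundle 𝓘(ℝ, E) M))) (p : M) :
    ContDiffAt ℝ 1 (coordField V p ∘ (extChartAt 𝓘(ℝ, E) p).symm) (extChartAt 𝓘(ℝ, E) p p) := by
  have h := (contMDiffAt_iff.1 (contMDiffAt_coordField hV p)).2
  rw [modelWithCornersSelf_coe, range_id, contDiffWithinAt_univ] at h
  exact h

lemma hasFDerivAt_coordField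
    (hV : ContMDiff 𝓘(ℝ, E) 𝓘(ℝ, E).tangent 1
      (fun x : M => (⟨x, V x⟩ : TangentBundle 𝓘(ℝ, E) M))) (p : M) :
    HasFDerivAt (coordField V p ∘ (extChartAt 𝓘(ℝ, E) p).symm) (derivAt V p : E →L[ℝ] E)
      (extChartAt 𝓘(ℝ, E) p p) := by
  have h := ((contMDiffAt_coordField hV p).mdifferentiableAt one_ne_zero).hasMFDerivAt.2
  rw [modelWithCornersSelf_coe, range_id] at h
  exact hasFDerivWithinAt_univ.1 h

lemma coordField_eq_continuousLinearMapAt {p x : M} (hx : x ∈ (chartAt E p).source) :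
    coordField V p x =
      (trivializationAt E (TangentSpace 𝓘(ℝ, E) : M → Type _) p).continuousLinearMapAt ℝ x (V x) := by
  rw [Trivialization.continuousLinearMapAt_apply, Trivialization.linearMapAt_apply, if_pos]
  · rfl
  · simpa using hx

variable [RiemannianBundle (fun x : M => TangentSpace 𝓘(ℝ, E) x)]
    [IsContinuousRiemannianBundle E (fun x : M => TangentSpace 𝓘(ℝ, E) x)]

/-- The norm of `V` is locally comparable with the norm of its coordinate expression. -/
lemma exists_norm_coordField_comparable (V : (x : M) → TangentSpace 𝓘(ℝ, E) x) (p : M) :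
    ∃ C > 0, ∀ᶠ x in 𝓝 p, ‖coordField V p x‖ ≤ C * ‖V x‖ ∧ ‖V x‖ ≤ C * ‖coordField V p x‖ := by
  obtain ⟨C, hC, h⟩ := eventually_norm_trivializationAt_lt E
    (fun x : M => TangentSpace 𝓘(ℝ, E) x) p
  obtain ⟨C', hC', h'⟩ := eventually_norm_symmL_trivializationAt_lt E
    (fun x : M => TangentSpace 𝓘(ℝ, E) x) p
  refine ⟨max C C', by positivity, ?_⟩
  filter_upwards [h, h', chart_source_mem_nhds E p] with x hx hx' hxs
  have hxb : x ∈ (trivializationAt E (TangentSpace 𝓘(ℝ, E) : M → Type _) p).baseSet := by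
    simpa using hxs
  rw [coordField_eq_continuousLinearMapAt hxs]
  constructor
  · exact (ContinuousLinearMap.le_of_opNorm_le _ hx.le _).trans (by gcongr; exact le_max_left _ _)
  · have := ContinuousLinearMap.le_of_opNorm_le _ hx'.le
      ((trivializationAt E (TangentSpace 𝓘(ℝ, E) : M → Type _) p).continuousLinearMapAt ℝ x (V x))
    rw [Trivialization.symmL_continuousLinearMapAt _ hxb] at this
    exact this.trans (by gcongr; exact le_max_right _ _)

end Local

end SingularFlow

namespace SingularFlow

open Filter Topology MeasureTheory Manifold
open scoped NNReal ENNReal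

/-! ### Charts and the Riemannian distance. -/

section Chart

variable
    {E : Type*} [NormedAddCommGroup E] [NormedSpace ℝ E]
    {M : Type*} [MetricSpace M]
    [ChartedSpace E M] [IsManifold 𝓘(ℝ, E) 1 M]

/-- The trivialization at `p` acts on fibres as the derivative of the chart at `p`, so operator norm
bounds on the trivialization control velocities read in the chart. -/
lemma hasDerivWithinAt_extChartAt_comp {p : M} {γ : ℝ → M} {s : Set ℝ} {t : ℝ}
    (hγ : MDifferentiableWithinAt 𝓘(ℝ, ℝ) 𝓘(ℝ, E) γ s t) (hs : γ t ∈ (chartAt E p).source) :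
    HasDerivWithinAt (extChartAt 𝓘(ℝ, E) p ∘ γ)
      ((trivializationAt E (TangentSpace 𝓘(ℝ, E) : M → Type _) p).continuousLinearMapAt ℝ (γ t)
        (mfderivWithin 𝓘(ℝ, ℝ) 𝓘(ℝ, E) γ s t (1 : ℝ))) s t := by
  rw [TangentBundle.continuousLinearMapAt_trivializationAt hs]
  have h := (mdifferentiableAt_extChartAt (I := 𝓘(ℝ, E)) hs).hasMFDerivAt.comp_hasMFDerivWithinAt t
    hγ.hasMFDerivWithinAt
  have key : ∀ (f : ℝ → E) (L : ℝ →L[ℝ] E), HasFDerivWithinAt f L s t →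
      HasDerivWithinAt f (L 1) s t := fun f L hL => hL.hasDerivWithinAt
  exact key _ _ (hasMFDerivWithinAt_iff_hasFDerivWithinAt.1 h)

variable [RiemannianBundle (fun x : M => TangentSpace 𝓘(ℝ, E) x)]

/-- The Riemannian length of a path controls the distance of its endpoints in a chart. -/
lemma enorm_extChartAt_sub_le {p : M} {C : ℝ≥0} {γ : ℝ → M}
    (hγ : ContMDiffOn 𝓘(ℝ, ℝ) 𝓘(ℝ, E) 1 γ (Icc 0 1))
    (hs : ∀ t ∈ Icc (0 : ℝ) 1, γ t ∈ (chartAt E p).source)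
    (hC : ∀ t ∈ Icc (0 : ℝ) 1, ‖(trivializationAt E (TangentSpace 𝓘(ℝ, E) : M → Type _)
      p).continuousLinearMapAt ℝ (γ t)‖ ≤ C) :
    ‖extChartAt 𝓘(ℝ, E) p (γ 1) - extChartAt 𝓘(ℝ, E) p (γ 0)‖ₑ ≤
      C * pathELength 𝓘(ℝ, E) γ 0 1 := by
  have hsmooth : ContDiffOn ℝ 1 (extChartAt 𝓘(ℝ, E) p ∘ γ) (Icc 0 1) := by
    rw [← contMDiffOn_iff_contDiffOn]
    exact contMDiffOn_extChartAt.comp (t := (chartAt E p).source) hγ hs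
  calc ‖extChartAt 𝓘(ℝ, E) p (γ 1) - extChartAt 𝓘(ℝ, E) p (γ 0)‖ₑ
      ≤ ∫⁻ t in Icc (0 : ℝ) 1, ‖derivWithin (extChartAt 𝓘(ℝ, E) p ∘ γ) (Icc 0 1) t‖ₑ :=
        enorm_sub_le_lintegral_derivWithin_Icc_of_contDiffOn_Icc hsmooth zero_le_one
    _ ≤ ∫⁻ t in Icc (0 : ℝ) 1, C * ‖mfderivWithin 𝓘(ℝ, ℝ) 𝓘(ℝ, E) γ (Icc 0 1) t (1 : ℝ)‖ₑ := by
        refine setLIntegral_mono' measurableSet_Icc fun t ht => ?_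
        rw [(hasDerivWithinAt_extChartAt_comp (hγ.mdifferentiableOn one_ne_zero t ht)
          (hs t ht)).derivWithin (uniqueDiffOn_Icc zero_lt_one t ht)]
        rw [← ofReal_norm, ← ofReal_norm, ← ENNReal.ofReal_coe_nnreal,
          ← ENNReal.ofReal_mul C.coe_nonneg]
        exact ENNReal.ofReal_le_ofReal (ContinuousLinearMap.le_of_opNorm_le _ (hC t ht) _)
    _ = C * pathELength 𝓘(ℝ, E) γ 0 1 := by
        rw [lintegral_const_mul' _ _ ENNReal.coe_ne_top,
          pathELength_eq_lintegral_mfderivWithin_Icc]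
        rfl

variable [IsContinuousRiemannianBundle E (fun x : M => TangentSpace 𝓘(ℝ, E) x)]
    [IsRiemannianManifold 𝓘(ℝ, E) M]

/-- Charts of a Riemannian manifold are locally Lipschitz for the Riemannian distance. -/
lemma exists_norm_extChartAt_sub_le (p : M) :
    ∃ C > 0, ∃ U ∈ 𝓝 p, ∀ z ∈ U, ∀ w ∈ U,
      ‖extChartAt 𝓘(ℝ, E) p z - extChartAt 𝓘(ℝ, E) p w‖ ≤ C * dist z w := by
  obtain ⟨C, hC, h⟩ := eventually_norm_trivializationAt_lt E
    (fun x : M => TangentSpace 𝓘(ℝ, E) x) p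
  obtain ⟨r, hr, hball⟩ := Metric.eventually_nhds_iff_ball.1
    (h.and (chart_source_mem_nhds E p))
  lift C to ℝ≥0 using hC.le
  -- Two points of this ball are less than `r / 2` apart. A path of length less than `r / 2` joining
  -- them stays in `ball p r`, where the trivialization is bounded.
  refine ⟨C, hC, Metric.ball p (r / 4), Metric.ball_mem_nhds _ (by positivity),
    fun z hz w hw => ?_⟩
  rw [Metric.mem_ball] at hz hw
  have hzw : dist z w < r / 2 := by
    linarith [dist_triangle_right z w p]
  -- The distance is an infimum of lengths that need not be attained, hence the slack `b`.
  refine le_of_forall_gt_imp_ge_of_dense fun b hb => ?_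
  obtain ⟨l, hl, hlb, hlr⟩ : ∃ l, dist z w < l ∧ C * l ≤ b ∧ l < r / 2 := by
    have hC' : (0 : ℝ) < C := hC
    obtain ⟨l, h1, h2⟩ := exists_between (lt_min hzw ((lt_div_iff₀' hC').2 hb))
    exact ⟨l, h1, by
      have := (lt_div_iff₀' hC').1 (h2.trans_le (min_le_right _ _)); exact this.le,
      h2.trans_le (min_le_left _ _)⟩
  have hedist : riemannianEDist 𝓘(ℝ, E) w z < ENNReal.ofReal l := by
    rw [← IsRiemannianManifold.out (I := 𝓘(ℝ, E)), edist_comm, edist_dist]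
    exact (ENNReal.ofReal_lt_ofReal_iff (dist_nonneg.trans_lt hl)).2 hl
  obtain ⟨γ, h0, h1, hγ, hlen⟩ := exists_lt_of_riemannianEDist_lt hedist
  have hmem : ∀ t ∈ Icc (0 : ℝ) 1, γ t ∈ Metric.ball p r := by
    intro t ht
    have hd : edist w (γ t) ≤ ENNReal.ofReal l := by
      rw [IsRiemannianManifold.out (I := 𝓘(ℝ, E))]
      exact (riemannianEDist_le_pathELength (hγ.mono (Icc_subset_Icc_right ht.2)) h0 rfl
        ht.1).trans ((pathELength_mono le_rfl ht.2).trans hlen.le)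
    rw [edist_dist, ENNReal.ofReal_le_ofReal_iff (dist_nonneg.trans hl.le)] at hd
    rw [Metric.mem_ball]
    linarith [dist_triangle_left (γ t) p w, dist_comm p w]
  have key := enorm_extChartAt_sub_le (p := p) hγ (fun t ht => (hball _ (hmem t ht)).2)
    (fun t ht => (hball _ (hmem t ht)).1.le)
  rw [h0, h1] at key
  have key2 := key.trans (mul_le_mul_right hlen.le (C : ℝ≥0∞))
  rw [← ofReal_norm, ← ENNReal.ofReal_coe_nnreal, ← ENNReal.ofReal_mul C.coe_nonneg,
    ENNReal.ofReal_le_ofReal_iff (mul_nonneg C.coe_nonneg (dist_nonneg.trans hl.le))] at key2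
  exact key2.trans hlb

/-- The Riemannian distance to `p` is locally bounded by the distance in the chart at `p`. -/
lemma exists_dist_le_norm_extChartAt_sub (p : M) :
    ∃ C > 0, ∀ᶠ x in 𝓝 p,
      dist x p ≤ C * ‖extChartAt 𝓘(ℝ, E) p x - extChartAt 𝓘(ℝ, E) p p‖ := by
  obtain ⟨C, hC, h⟩ := eventually_riemannianEDist_le_edist_extChartAt 𝓘(ℝ, E) p
  refine ⟨C, hC, ?_⟩
  filter_upwards [h] with x hx
  rw [← IsRiemannianManifold.out (I := 𝓘(ℝ, E)), edist_dist, edist_dist,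
    ← ENNReal.ofReal_coe_nnreal, ← ENNReal.ofReal_mul C.coe_nonneg,
    ENNReal.ofReal_le_ofReal_iff (by positivity)] at hx
  rwa [dist_comm, ← dist_eq_norm, dist_comm (extChartAt 𝓘(ℝ, E) p x)]

end Chart

end SingularFlow

namespace SingularFlow

open Filter Topology

/-! ### Integral curves with uniform existence time and displacement. -/

section Flow

variable
    {E : Type*} [NormedAddCommGroup E] [NormedSpace ℝ E]
    {M : Type*} [MetricSpace M]
    [ChartedSpace E M] [IsManifold 𝓘(ℝ, E) 1 M]
    {V : (x : M) → TangentSpace 𝓘(ℝ, E) x}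

/-- A solution of the differential equation in a chart yields an integral curve of `V`. -/
lemma hasMFDerivAt_extChartAt_symm_comp {p : M} {α : ℝ → E} {t : ℝ}
    (ht : α t ∈ (extChartAt 𝓘(ℝ, E) p).target)
    (hα : HasDerivAt α ((coordField V p ∘ (extChartAt 𝓘(ℝ, E) p).symm) (α t)) t) :
    HasMFDerivAt 𝓘(ℝ, ℝ) 𝓘(ℝ, E) ((extChartAt 𝓘(ℝ, E) p).symm ∘ α) t
      ((1 : ℝ →L[ℝ] ℝ).smulRight (V ((extChartAt 𝓘(ℝ, E) p).symm (α t)))) := by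
  set x := (extChartAt 𝓘(ℝ, E) p).symm (α t) with hx
  have hxs : x ∈ (chartAt E p).source := by
    rw [← extChartAt_source 𝓘(ℝ, E)]
    exact (extChartAt 𝓘(ℝ, E) p).map_target ht
  have hxα : extChartAt 𝓘(ℝ, E) p x = α t := (extChartAt 𝓘(ℝ, E) p).right_inv ht
  have hsymm := (mdifferentiableWithinAt_extChartAt_symm ht).hasMFDerivWithinAt
  rw [modelWithCornersSelf_coe, range_id, hasMFDerivWithinAt_univ] at hsymm
  have hcomp := hsymm.comp t (hasMFDerivAt_iff_hasFDerivAt.2 hα.hasFDerivAt)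
  refine hcomp.congr_mfderiv ?_
  have hxb : x ∈ (trivializationAt E (TangentSpace 𝓘(ℝ, E) : M → Type _) p).baseSet := by
    simpa using hxs
  have hV := Trivialization.symmL_continuousLinearMapAt (R := ℝ) _ hxb (V x)
  rw [← coordField_eq_continuousLinearMapAt hxs, TangentBundle.symmL_trivializationAt hxs,
    hxα, modelWithCornersSelf_coe, range_id] at hV
  have key : ∀ (L : E →L[ℝ] E) (v w : E), L v = w →
      L.comp (ContinuousLinearMap.toSpanSingleton ℝ v) = (1 : ℝ →L[ℝ] ℝ).smulRight w := by
    rintro L v _ rfl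
    ext
    simp
  exact key _ _ _ hV

variable [RiemannianBundle (fun x : M => TangentSpace 𝓘(ℝ, E) x)]
    [IsContinuousRiemannianBundle E (fun x : M => TangentSpace 𝓘(ℝ, E) x)]
    [IsRiemannianManifold 𝓘(ℝ, E) M]

/-- Near every point, integral curves exist for a uniform time, and move away from their initial
point with speed at least a fixed fraction of the norm of the vector field there. -/
lemma exists_local_isMIntegralCurveOn [CompleteSpace E]
    (hV : ContMDiff 𝓘(ℝ, E) 𝓘(ℝ, E).tangent 1
      (fun x : M => (⟨x, V x⟩ : TangentBundle 𝓘(ℝ, E) M))) (p : M) :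
    ∃ ε > 0, ∃ c > 0, ∀ᶠ z in 𝓝 p, ∃ γ : ℝ → M, γ 0 = z ∧ IsMIntegralCurveOn γ V (Ioo (-ε) ε) ∧
      ∀ t ∈ Ioo (-ε) ε, c * (|t| * ‖V z‖) ≤ dist (γ t) z := by
  obtain ⟨C₁, hC₁, U, hU, hlip⟩ := exists_norm_extChartAt_sub_le (E := E) p
  obtain ⟨C₂, hC₂, hcomp⟩ := exists_norm_coordField_comparable V p
  obtain ⟨r, hr, ε, hε, hflow⟩ := exists_local_flow_of_contDiffAt (contDiffAt_coordField hV p)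
    (inter_mem (extChartAt_target_mem_nhds (I := 𝓘(ℝ, E)) p)
      (extChartAt_preimage_mem_nhds (I := 𝓘(ℝ, E)) hU))
  refine ⟨ε, hε, (2 * C₁ * C₂)⁻¹, by positivity, ?_⟩
  filter_upwards [hcomp, hU, extChartAt_source_mem_nhds (I := 𝓘(ℝ, E)) p,
    (continuousAt_extChartAt (I := 𝓘(ℝ, E)) p).preimage_mem_nhds
      (Metric.closedBall_mem_nhds _ hr)] with z hz hzU hzs hzr
  obtain ⟨α, hα0, hα⟩ := hflow _ hzr
  have hleft := (extChartAt 𝓘(ℝ, E) p).left_inv hzs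
  refine ⟨(extChartAt 𝓘(ℝ, E) p).symm ∘ α, by simp only [Function.comp_apply, hα0, hleft],
    fun t ht => (hasMFDerivAt_extChartAt_symm_comp (hα t ht).2.1.1
      (hα t ht).1).hasMFDerivWithinAt, fun t ht => ?_⟩
  obtain ⟨-, ⟨ht1, ht2⟩, ht3⟩ := hα t ht
  have h1 := hlip _ ht2 z hzU
  rw [(extChartAt 𝓘(ℝ, E) p).right_inv ht1] at h1
  rw [Function.comp_apply, hleft] at ht3
  rw [inv_mul_le_iff₀ (by positivity)]
  calc |t| * ‖V z‖ ≤ |t| * (C₂ * ‖coordField V p z‖) := by gcongr; exact hz.2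
    _ = C₂ * (|t| * ‖coordField V p z‖) := by ring
    _ ≤ C₂ * (2 * (C₁ * dist ((extChartAt 𝓘(ℝ, E) p).symm (α t)) z)) := by
        exact mul_le_mul_of_nonneg_left
          (ht3.trans (mul_le_mul_of_nonneg_left h1 zero_le_two)) hC₂.le
    _ = 2 * C₁ * C₂ * dist (((extChartAt 𝓘(ℝ, E) p).symm ∘ α) t) z := by
        rw [Function.comp_apply]; ring

/-- Both constants may be decreased, so local choices combine by compactness. The time `ε` yields
completeness of the flow, and `c` its displacement bound. -/
lemma exists_uniform_isMIntegralCurveOn [CompleteSpace E] [CompactSpace M]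
    (hV : ContMDiff 𝓘(ℝ, E) 𝓘(ℝ, E).tangent 1
      (fun x : M => (⟨x, V x⟩ : TangentBundle 𝓘(ℝ, E) M))) :
    ∃ ε > 0, ∃ c > 0, ∀ z, ∃ γ : ℝ → M, γ 0 = z ∧ IsMIntegralCurveOn γ V (Ioo (-ε) ε) ∧
      ∀ t ∈ Ioo (-ε) ε, c * (|t| * ‖V z‖) ≤ dist (γ t) z := by
  have h := isCompact_univ.induction_on (X := M)
    (p := fun S => ∃ ε > 0, ∃ c > 0, ∀ z ∈ S, ∃ γ : ℝ → M, γ 0 = z ∧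
      IsMIntegralCurveOn γ V (Ioo (-ε) ε) ∧ ∀ t ∈ Ioo (-ε) ε, c * (|t| * ‖V z‖) ≤ dist (γ t) z)
    ⟨1, one_pos, 1, one_pos, fun z hz => hz.elim⟩
    (fun S T hST ⟨ε, hε, c, hc, h⟩ => ⟨ε, hε, c, hc, fun z hz => h z (hST hz)⟩)
    ?_ ?_
  · obtain ⟨ε, hε, c, hc, h⟩ := h
    exact ⟨ε, hε, c, hc, fun z => h z (mem_univ z)⟩
  · have shrink : ∀ {ε c ε' c' : ℝ} {z : M}, ε' ≤ ε → c' ≤ c →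
        (∃ γ : ℝ → M, γ 0 = z ∧ IsMIntegralCurveOn γ V (Ioo (-ε) ε) ∧
          ∀ t ∈ Ioo (-ε) ε, c * (|t| * ‖V z‖) ≤ dist (γ t) z) →
        ∃ γ : ℝ → M, γ 0 = z ∧ IsMIntegralCurveOn γ V (Ioo (-ε') ε') ∧
          ∀ t ∈ Ioo (-ε') ε', c' * (|t| * ‖V z‖) ≤ dist (γ t) z := by
      rintro ε c ε' c' z hε hc ⟨γ, h0, hγ, hd⟩
      have hsub : Ioo (-ε') ε' ⊆ Ioo (-ε) ε := Ioo_subset_Ioo (neg_le_neg hε) hε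
      exact ⟨γ, h0, hγ.mono hsub, fun t ht => (mul_le_mul_of_nonneg_right hc
        (by positivity)).trans (hd t (hsub ht))⟩
    rintro S T ⟨ε, hε, c, hc, h⟩ ⟨ε', hε', c', hc', h'⟩
    refine ⟨min ε ε', lt_min hε hε', min c c', lt_min hc hc', ?_⟩
    rintro z (hz | hz)
    · exact shrink (min_le_left _ _) (min_le_left _ _) (h z hz)
    · exact shrink (min_le_right _ _) (min_le_right _ _) (h' z hz)
  · intro p _
    obtain ⟨ε, hε, c, hc, h⟩ := exists_local_isMIntegralCurveOn hV p
    exact ⟨_, mem_nhdsWithin_of_mem_nhds h, ε, hε, c, hc, fun z hz => hz⟩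

end Flow

/-! ### The global flow. -/

section FlowProperties

variable
    {E : Type*} [NormedAddCommGroup E] [NormedSpace ℝ E] [CompleteSpace E]
    {M : Type*} [MetricSpace M] [CompactSpace M]
    [ChartedSpace E M] [IsManifold 𝓘(ℝ, E) 1 M]
    [RiemannianBundle (fun x : M => TangentSpace 𝓘(ℝ, E) x)]
    [IsContinuousRiemannianBundle E (fun x : M => TangentSpace 𝓘(ℝ, E) x)]
    [IsRiemannianManifold 𝓘(ℝ, E) M]
    {V : (x : M) → TangentSpace 𝓘(ℝ, E) x}

/-- A uniform existence time lets every integral curve be continued to all of `ℝ`, so the `if` in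
`flow` always takes its first branch. -/
lemma flow_spec
    (hV : ContMDiff 𝓘(ℝ, E) 𝓘(ℝ, E).tangent 1
      (fun x : M => (⟨x, V x⟩ : TangentBundle 𝓘(ℝ, E) M))) (x : M) :
    flow V 0 x = x ∧ IsMIntegralCurve (fun t => flow V t x) V := by
  obtain ⟨ε, hε, c, -, h⟩ := exists_uniform_isMIntegralCurveOn hV
  have hex : ∃ γ : ℝ → M, γ 0 = x ∧ IsMIntegralCurve γ V :=
    exists_isMIntegralCurve_of_isMIntegralCurveOn hV hε
      (fun z => let ⟨γ, h0, hγ, _⟩ := h z; ⟨γ, h0, hγ⟩) x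
  have heq : (fun t => flow V t x) = Classical.choose hex := by
    ext t
    rw [flow, dif_pos hex]
  have h0 : flow V 0 x = Classical.choose hex 0 := congrFun heq 0
  rw [h0, heq]
  exact Classical.choose_spec hex

/-- As functions of `s`, both sides are integral curves through `flow V t x` at `s = 0`; uniqueness
identifies them. -/
lemma flow_add
    (hV : ContMDiff 𝓘(ℝ, E) 𝓘(ℝ, E).tangent 1
      (fun x : M => (⟨x, V x⟩ : TangentBundle 𝓘(ℝ, E) M))) (s t : ℝ) (x : M) :
    flow V (s + t) x = flow V s (flow V t x) := by
  have h := isMIntegralCurve_Ioo_eq_of_contMDiff_boundaryless (t₀ := 0) hV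
    ((flow_spec hV x).2.comp_add t) (flow_spec hV (flow V t x)).2
    (by simp [(flow_spec hV _).1])
  exact congrFun h s

/-- For small times the flow moves every point `z` by at least a fixed fraction of
`|t| * ‖V z‖`. -/
lemma exists_le_dist_flow
    (hV : ContMDiff 𝓘(ℝ, E) 𝓘(ℝ, E).tangent 1
      (fun x : M => (⟨x, V x⟩ : TangentBundle 𝓘(ℝ, E) M))) :
    ∃ ε > 0, ∃ c > 0, ∀ z, ∀ t ∈ Ioo (-ε) ε, c * (|t| * ‖V z‖) ≤ dist (flow V t z) z := by
  obtain ⟨ε, hε, c, hc, h⟩ := exists_uniform_isMIntegralCurveOn hV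
  refine ⟨ε, hε, c, hc, fun z t ht => ?_⟩
  obtain ⟨γ, h0, hγ, hd⟩ := h z
  have heq := isMIntegralCurveOn_Ioo_eqOn_of_contMDiff_boundaryless (t₀ := 0)
    ⟨neg_lt_zero.2 hε, hε⟩ hV hγ ((flow_spec hV z).2.isMIntegralCurveOn _)
    (by rw [h0, (flow_spec hV z).1])
  exact (hd t ht).trans_eq (congrArg (dist · z) (heq ht))

end FlowProperties

end SingularFlow

namespace SingularFlow

open Filter Topology

/-! ### Distance to a set. -/

section DistTo

variable {X : Type*} [MetricSpace X]

lemma distTo_of_nonempty {A : Set X} (hA : A.Nonempty) (z : X) :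
    distTo z A = Metric.infDist z A := if_pos hA

lemma distTo_empty (z : X) : distTo z (∅ : Set X) = Metric.diam (univ : Set X) :=
  if_neg Set.not_nonempty_empty

lemma distTo_le_diam [CompactSpace X] (z : X) (A : Set X) :
    distTo z A ≤ Metric.diam (univ : Set X) := by
  rcases A.eq_empty_or_nonempty with rfl | hA
  · rw [distTo_empty]
  · rw [distTo_of_nonempty hA]
    obtain ⟨a, ha⟩ := hA
    exact (Metric.infDist_le_dist_of_mem ha).trans
      (Metric.dist_le_diam_of_mem isCompact_univ.isBounded (mem_univ _) (mem_univ _))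

/-- The distance to `A` from points near a point outside the closure of `A` is bounded below. -/
lemma le_distTo_of_disjoint_ball {A : Set X} {p z : X} {r : ℝ}
    (hA : ∀ a ∈ A, r ≤ dist a p) (hz : dist z p ≤ r / 2) :
    min (r / 2) (Metric.diam (univ : Set X)) ≤ distTo z A := by
  rcases A.eq_empty_or_nonempty with rfl | hne
  · rw [distTo_empty]
    exact min_le_right _ _
  · rw [distTo_of_nonempty hne]
    refine (min_le_left _ _).trans ((Metric.le_infDist hne).2 fun a ha => ?_)
    linarith [hA a ha, dist_triangle_left a p z, dist_comm z a]

/-- Near an isolated point `p` of `A`, the distance to `A` is the distance to `p`. -/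
lemma distTo_eq_dist_of_isolated {A : Set X} {p z : X} {r : ℝ} (hp : p ∈ A)
    (hA : ∀ a ∈ A, a ≠ p → r ≤ dist a p) (hz : dist z p ≤ r / 2) : distTo z A = dist z p := by
  rw [distTo_of_nonempty ⟨p, hp⟩]
  refine le_antisymm (Metric.infDist_le_dist_of_mem hp) ((Metric.le_infDist ⟨p, hp⟩).2 fun a ha => ?_)
  by_cases hap : a = p
  · rw [hap]
  · linarith [hA a ha hap, dist_triangle_left a p z, dist_comm z a]

end DistTo

/-! ### Comparing the norm of the field with the distance to its zeros. -/

section Comparison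

variable
    {E : Type*} [NormedAddCommGroup E] [NormedSpace ℝ E] [FiniteDimensional ℝ E]
    {M : Type*} [MetricSpace M]
    [ChartedSpace E M] [IsManifold 𝓘(ℝ, E) 1 M]
    [RiemannianBundle (fun x : M => TangentSpace 𝓘(ℝ, E) x)]
    [IsContinuousRiemannianBundle E (fun x : M => TangentSpace 𝓘(ℝ, E) x)]
    [IsRiemannianManifold 𝓘(ℝ, E) M]
    {V : (x : M) → TangentSpace 𝓘(ℝ, E) x}

/-- Near a nondegenerate singularity, the norm of `V` is comparable with the distance to it. -/
lemma exists_norm_comparable_dist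
    (hV : ContMDiff 𝓘(ℝ, E) 𝓘(ℝ, E).tangent 1
      (fun x : M => (⟨x, V x⟩ : TangentBundle 𝓘(ℝ, E) M))) {σ : M} (hσ : V σ = 0)
    (hDV : Function.Injective (derivAt V σ)) :
    ∃ C > 0, ∀ᶠ x in 𝓝 σ, ‖V x‖ ≤ C * dist x σ ∧ dist x σ ≤ C * ‖V x‖ := by
  obtain ⟨C₁, hC₁, U, hU, hlip⟩ := exists_norm_extChartAt_sub_le (E := E) σ
  obtain ⟨C₂, hC₂, hcomp⟩ := exists_norm_coordField_comparable V σ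
  obtain ⟨C₃, hC₃, hdist⟩ := exists_dist_le_norm_extChartAt_sub (E := E) σ
  have hf := hasFDerivAt_coordField hV σ
  -- In finite dimension an injective linear map is bounded below, so increments of the coordinate
  -- field are of the exact order of increments of the point.
  have hind : IsInducing (derivAt V σ : E →L[ℝ] E) := by
    have h : ∀ A : E →L[ℝ] E, Function.Injective A → IsInducing A := fun A hA =>
      (LinearMap.isClosedEmbedding_of_injective (LinearMap.ker_eq_bot.2 hA)).isInducing
    exact h _ hDV
  obtain ⟨C₄, hC₄, h4⟩ := (hf.isTheta_sub hind).1.exists_pos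
  obtain ⟨C₅, hC₅, h5⟩ := (hf.isTheta_sub hind).2.exists_pos
  have hcont := continuousAt_extChartAt (I := 𝓘(ℝ, E)) σ
  have h0 : coordField V σ σ = 0 := by
    rw [coordField_eq_continuousLinearMapAt (mem_chart_source E σ), hσ, map_zero]
  refine ⟨max (C₂ * (C₄ * C₁)) (C₃ * (C₅ * C₂)), by positivity, ?_⟩
  filter_upwards [hcomp, hU, hdist, hcont.eventually h4.bound, hcont.eventually h5.bound,
    extChartAt_source_mem_nhds (I := 𝓘(ℝ, E)) σ] with x hx hxU hxd hx4 hx5 hxs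
  simp only [Function.comp_apply, (extChartAt 𝓘(ℝ, E) σ).left_inv hxs,
    (extChartAt 𝓘(ℝ, E) σ).left_inv (mem_extChartAt_source σ), h0, sub_zero] at hx4 hx5
  constructor
  · calc ‖V x‖ ≤ C₂ * ‖coordField V σ x‖ := hx.2
      _ ≤ C₂ * (C₄ * (C₁ * dist x σ)) := mul_le_mul_of_nonneg_left
          (hx4.trans (mul_le_mul_of_nonneg_left (hlip x hxU σ (mem_of_mem_nhds hU)) hC₄.le)) hC₂.le
      _ = C₂ * (C₄ * C₁) * dist x σ := by ring
      _ ≤ _ := mul_le_mul_of_nonneg_right (le_max_left _ _) dist_nonneg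
  · calc dist x σ ≤ C₃ * ‖extChartAt 𝓘(ℝ, E) σ x - extChartAt 𝓘(ℝ, E) σ σ‖ := hxd
      _ ≤ C₃ * (C₅ * (C₂ * ‖V x‖)) := mul_le_mul_of_nonneg_left
          (hx5.trans (mul_le_mul_of_nonneg_left hx.1 hC₅.le)) hC₃.le
      _ = C₃ * (C₅ * C₂) * ‖V x‖ := by ring
      _ ≤ _ := mul_le_mul_of_nonneg_right (le_max_right _ _) (norm_nonneg _)

variable [CompactSpace M]

/-- Needed for `Sing V = ∅`, where `distTo` is the diameter. A point with nonzero velocity moves, so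
the space has two distinct points. -/
lemma diam_pos_of_ne_zero
    (hV : ContMDiff 𝓘(ℝ, E) 𝓘(ℝ, E).tangent 1
      (fun x : M => (⟨x, V x⟩ : TangentBundle 𝓘(ℝ, E) M))) {p : M} (hp : V p ≠ 0) :
    0 < Metric.diam (univ : Set M) := by
  have : CompleteSpace E := FiniteDimensional.complete ℝ E
  obtain ⟨ε, hε, c, hc, h⟩ := exists_le_dist_flow hV
  have hε2 : ε / 2 ∈ Ioo (-ε) ε := by constructor <;> linarith
  have hpos : 0 < c * (|ε / 2| * ‖V p‖) := by
    have := norm_pos_iff.2 hp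
    positivity
  exact hpos.trans_le ((h p _ hε2).trans
    (Metric.dist_le_diam_of_mem isCompact_univ.isBounded (mem_univ _) (mem_univ _)))

/-- The norm of `V` is locally comparable with the distance to the singular set. -/
lemma exists_local_norm_comparable_distTo
    (hV : ContMDiff 𝓘(ℝ, E) 𝓘(ℝ, E).tangent 1
      (fun x : M => (⟨x, V x⟩ : TangentBundle 𝓘(ℝ, E) M)))
    (hDV : ∀ σ ∈ Sing V, Function.Injective (derivAt V σ)) (p : M) :
    ∃ C > 0, ∀ᶠ x in 𝓝 p, ‖V x‖ ≤ C * distTo x (Sing V) ∧ distTo x (Sing V) ≤ C * ‖V x‖ := by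
  by_cases hp : V p = 0
  · obtain ⟨C, hC, h⟩ := exists_norm_comparable_dist hV hp (hDV p hp)
    obtain ⟨r, hr, hball⟩ := Metric.eventually_nhds_iff_ball.1 h
    refine ⟨C, hC, ?_⟩
    filter_upwards [Metric.ball_mem_nhds p (half_pos hr), h] with x hx hxC
    rwa [distTo_eq_dist_of_isolated (A := Sing V) (p := p) hp (fun a ha hap => ?_) (Metric.mem_ball.1 hx).le]
    -- A further zero `a` in the ball would satisfy `dist a p ≤ C * 0`.
    by_contra! hlt
    have h2 := (hball a hlt).2
    rw [show V a = 0 from ha, norm_zero, mul_zero] at h2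
    exact hap (dist_le_zero.1 h2)
  -- At a regular point, continuity of the coordinate field bounds `‖V x‖` above and away from zero.
  -- The lower bound keeps zeros out of a ball, which bounds `distTo` below.
  · obtain ⟨C, hC, hcomp⟩ := exists_norm_coordField_comparable V p
    have hD := diam_pos_of_ne_zero hV hp
    have hm : 0 < ‖coordField V p p‖ := by
      have h1 := norm_pos_iff.2 hp
      have h2 := (hcomp.self_of_nhds).2
      exact pos_of_mul_pos_right (h1.trans_le h2) hC.le
    set m := ‖coordField V p p‖ with hmdef
    have hcont : ContinuousAt (fun x => ‖coordField V p x‖) p :=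
      (contMDiffAt_coordField hV p).continuousAt.norm
    have hlow : ∀ᶠ x in 𝓝 p, m / (2 * C) ≤ ‖V x‖ := by
      filter_upwards [hcomp, hcont.eventually_const_lt (half_lt_self hm)] with x hx hx2
      rw [div_le_iff₀ (by positivity)]
      linarith [hx.1]
    have hup : ∀ᶠ x in 𝓝 p, ‖V x‖ ≤ C * (2 * m) := by
      filter_upwards [hcomp, hcont.eventually_lt_const (show m < 2 * m by linarith)] with x hx hx2
      exact hx.2.trans (mul_le_mul_of_nonneg_left hx2.le hC.le)
    obtain ⟨r, hr, hball⟩ := Metric.eventually_nhds_iff_ball.1 hlow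
    have hmC : 0 < m / (2 * C) := by positivity
    have hl : 0 < min (r / 2) (Metric.diam (univ : Set M)) := lt_min (half_pos hr) hD
    set l := min (r / 2) (Metric.diam (univ : Set M))
    refine ⟨max (C * (2 * m) / l) (Metric.diam (univ : Set M) / (m / (2 * C))), by positivity, ?_⟩
    filter_upwards [Metric.ball_mem_nhds p (half_pos hr), hlow, hup] with x hx hx1 hx2
    have hdist : l ≤ distTo x (Sing V) := by
      refine le_distTo_of_disjoint_ball (fun a ha => ?_) (Metric.mem_ball.1 hx).le
      by_contra! hlt
      have h2 := hball a hlt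
      rw [show V a = 0 from ha, norm_zero] at h2
      exact hmC.not_ge h2
    constructor
    · calc ‖V x‖ ≤ C * (2 * m) := hx2
        _ = C * (2 * m) / l * l := by field_simp
        _ ≤ _ := mul_le_mul (le_max_left _ _) hdist hl.le (by positivity)
    · calc distTo x (Sing V) ≤ Metric.diam (univ : Set M) := distTo_le_diam _ _
        _ = Metric.diam (univ : Set M) / (m / (2 * C)) * (m / (2 * C)) := by field_simp
        _ ≤ _ := mul_le_mul (le_max_right _ _) hx1 hmC.le (by positivity)

/-- If all singularities are nondegenerate, the norm of `V` is comparable with the distance to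
the singular set. -/
lemma exists_norm_comparable_distTo
    (hV : ContMDiff 𝓘(ℝ, E) 𝓘(ℝ, E).tangent 1
      (fun x : M => (⟨x, V x⟩ : TangentBundle 𝓘(ℝ, E) M)))
    (hDV : ∀ σ ∈ Sing V, Function.Injective (derivAt V σ)) :
    ∃ C > 0, ∀ x, ‖V x‖ ≤ C * distTo x (Sing V) ∧ distTo x (Sing V) ≤ C * ‖V x‖ := by
  have hnonneg : ∀ x, 0 ≤ distTo x (Sing V) := fun x => by
    rcases (Sing V).eq_empty_or_nonempty with h | h
    · rw [h, distTo_empty]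
      exact Metric.diam_nonneg
    · rw [distTo_of_nonempty h]
      exact Metric.infDist_nonneg
  have h := isCompact_univ.induction_on (X := M)
    (p := fun S => ∃ C > 0, ∀ x ∈ S, ‖V x‖ ≤ C * distTo x (Sing V) ∧
      distTo x (Sing V) ≤ C * ‖V x‖)
    ⟨1, one_pos, fun z hz => hz.elim⟩
    (fun S T hST ⟨C, hC, h⟩ => ⟨C, hC, fun z hz => h z (hST hz)⟩)
    ?_ ?_
  · obtain ⟨C, hC, h⟩ := h
    exact ⟨C, hC, fun z => h z (mem_univ z)⟩
  · have mono : ∀ {C C' : ℝ} {x : M}, C ≤ C' →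
        ‖V x‖ ≤ C * distTo x (Sing V) ∧ distTo x (Sing V) ≤ C * ‖V x‖ →
        ‖V x‖ ≤ C' * distTo x (Sing V) ∧ distTo x (Sing V) ≤ C' * ‖V x‖ := fun {_ _ x} hC h =>
      ⟨h.1.trans (mul_le_mul_of_nonneg_right hC (hnonneg x)),
        h.2.trans (mul_le_mul_of_nonneg_right hC (norm_nonneg _))⟩
    rintro S T ⟨C, hC, h⟩ ⟨C', hC', h'⟩
    refine ⟨max C C', lt_max_of_lt_left hC, ?_⟩
    rintro z (hz | hz)
    · exact mono (le_max_left _ _) (h z hz)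
    · exact mono (le_max_right _ _) (h' z hz)
  · intro p _
    obtain ⟨C, hC, h⟩ := exists_local_norm_comparable_distTo hV hDV p
    exact ⟨_, mem_nhdsWithin_of_mem_nhds h, C, hC, fun z hz => hz⟩

end Comparison

end SingularFlow

namespace SingularFlow

open Filter Topology

/-! ### The two notions of expansivity. -/

section Expansive

variable
    {E : Type*} [NormedAddCommGroup E] [NormedSpace ℝ E] [CompleteSpace E]
    {M : Type*} [MetricSpace M] [CompactSpace M]
    [ChartedSpace E M] [IsManifold 𝓘(ℝ, E) 1 M]
    [RiemannianBundle (fun x : M => TangentSpace 𝓘(ℝ, E) x)]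
    [IsContinuousRiemannianBundle E (fun x : M => TangentSpace 𝓘(ℝ, E) x)]
    [IsRiemannianManifold 𝓘(ℝ, E) M]
    {V : (x : M) → TangentSpace 𝓘(ℝ, E) x} {Λ : Set M}

lemma flow_eq_self_of_eq_zero
    (hV : ContMDiff 𝓘(ℝ, E) 𝓘(ℝ, E).tangent 1
      (fun x : M => (⟨x, V x⟩ : TangentBundle 𝓘(ℝ, E) M))) {z : M} (hz : V z = 0) (t : ℝ) :
    flow V t z = z :=
  congrFun (isMIntegralCurve_Ioo_eq_of_contMDiff_boundaryless (t₀ := 0) hV (flow_spec hV z).2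
    (isMIntegralCurve_const hz) (flow_spec hV z).1) t

lemma apply_flow_ne_zero
    (hV : ContMDiff 𝓘(ℝ, E) 𝓘(ℝ, E).tangent 1
      (fun x : M => (⟨x, V x⟩ : TangentBundle 𝓘(ℝ, E) M))) {x : M} (hx : V x ≠ 0) (t : ℝ) :
    V (flow V t x) ≠ 0 := by
  intro h
  have h1 := flow_eq_self_of_eq_zero hV h (-t)
  rw [← flow_add hV, neg_add_cancel, (flow_spec hV x).1] at h1
  rw [← h1] at h
  exact hx h

/-- If a continuous time change along an orbit is once `e / 2`-close to the identity and the
shadowing error is small relative to `e` and to the vector field, then it is always `e`-close to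
the identity. -/
lemma abs_sub_lt_of_dist_flow_le
    (hV : ContMDiff 𝓘(ℝ, E) 𝓘(ℝ, E).tangent 1
      (fun x : M => (⟨x, V x⟩ : TangentBundle 𝓘(ℝ, E) M))) {ε c e δ : ℝ}
    (hd : ∀ z, ∀ t ∈ Ioo (-ε) ε, c * (|t| * ‖V z‖) ≤ dist (flow V t z) z)
    (heε : e < ε) (hδ : δ < c * e) {x : M} (hx : V x ≠ 0) {h : ℝ → ℝ}
    (hcont : Continuous h) {t₀ : ℝ} (ht₀ : |h t₀ - t₀| < e)
    (hdist : ∀ t, dist (flow V t x) (flow V (h t) x) ≤ δ * ‖V (flow V t x)‖) (t : ℝ) :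
    |h t - t| < e := by
  by_contra! hge
  -- At a time `τ` where the deviation equals `e` exactly, the displacement is at least `c * e *
  -- ‖V‖`, more than the shadowing bound `δ * ‖V‖` allows.
  obtain ⟨τ, hτ⟩ := mem_range_of_exists_le_of_exists_ge
    (f := fun t => |h t - t|) (hcont.sub continuous_id).abs ⟨t₀, ht₀.le⟩ ⟨t, hge⟩
  simp only at hτ
  have hpos : 0 < ‖V (flow V τ x)‖ := norm_pos_iff.2 (apply_flow_ne_zero hV hx τ)
  have h1 := hd (flow V τ x) (h τ - τ) (abs_lt.1 (hτ.trans_lt heε))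
  rw [← flow_add hV, sub_add_cancel, hτ, dist_comm] at h1
  nlinarith [hdist τ]

lemma SingularExpansiveOn.rescalingExpansiveOn
    (hV : ContMDiff 𝓘(ℝ, E) 𝓘(ℝ, E).tangent 1
      (fun x : M => (⟨x, V x⟩ : TangentBundle 𝓘(ℝ, E) M)))
    {C : ℝ} (hC : 0 < C) (hle : ∀ x, ‖V x‖ ≤ C * distTo x (Sing V))
    (hS : SingularExpansiveOn V Λ) : RescalingExpansiveOn V Λ := by
  intro ε hε
  obtain ⟨ε₀, hε₀, c, hc, hd⟩ := exists_le_dist_flow hV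
  -- `e < ε` gives the conclusion and `e < ε₀` the displacement bound. Using `e / 2` makes the
  -- deviation at `t₀` strictly less than `e`. In the choice of `δ`, `δ₁ / C` transfers the
  -- hypothesis and `c * e / 2` is below the threshold `c * e`.
  obtain ⟨e, he, heε⟩ := exists_between (lt_min hε hε₀)
  obtain ⟨δ₁, hδ₁, H⟩ := hS (e / 2) (half_pos he)
  refine ⟨min (δ₁ / C) (c * e / 2), lt_min (by positivity) (by positivity),
    fun x hx y hy s hs hxy => ?_⟩
  by_cases hVx : V x = 0
  · have h0 := hxy 0
    rw [(flow_spec hV x).1, hVx, norm_zero, mul_zero] at h0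
    exact ⟨0, ⟨by linarith, hε.le⟩, (flow_spec hV x).1.trans (dist_le_zero.1 h0)⟩
  obtain ⟨t₀, t₁, ht₁, heq⟩ := H x hx y hy s hs fun t => by
    calc _ ≤ min (δ₁ / C) (c * e / 2) * ‖V (flow V t x)‖ := hxy t
      _ ≤ δ₁ / C * ‖V (flow V t x)‖ :=
        mul_le_mul_of_nonneg_right (min_le_left _ _) (norm_nonneg _)
      _ ≤ δ₁ / C * (C * distTo (flow V t x) (Sing V)) := by gcongr; exact hle _
      _ = δ₁ * distTo (flow V t x) (Sing V) := by field_simp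
  -- The orbits of `x` and `y` meet, so the shadowing curve is a time change of the orbit of `x`.
  have hflow : ∀ t, flow V (s t) y = flow V (s t - s t₀ + t₁) x := fun t => by
    rw [flow_add hV, show flow V t₁ x = flow V (s t₀) y from heq, ← flow_add hV, sub_add_cancel]
  have hclose := abs_sub_lt_of_dist_flow_le hV (h := fun t => s t - s t₀ + t₁) (t₀ := t₀) hd
    (heε.trans_le (min_le_right _ _))
    ((min_le_right (δ₁ / C) (c * e / 2)).trans_lt (half_lt_self (by positivity))) hVx
    ((s.continuous.sub continuous_const).add continuous_const)
    (by
      rw [sub_self, zero_add, abs_lt]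
      constructor <;> linarith [ht₁.1, ht₁.2])
    (fun t => by rw [← hflow]; exact hxy t) 0
  rw [sub_zero, abs_lt] at hclose
  have := heε.trans_le (min_le_left _ _)
  exact ⟨_, ⟨by linarith [hclose.1], by linarith [hclose.2]⟩, (hflow 0).symm⟩

end Expansive

lemma RescalingExpansiveOn.singularExpansiveOn
    {E : Type*} [NormedAddCommGroup E] [NormedSpace ℝ E]
    {M : Type*} [MetricSpace M] [ChartedSpace E M]
    [RiemannianBundle (fun x : M => TangentSpace 𝓘(ℝ, E) x)]
    {V : (x : M) → TangentSpace 𝓘(ℝ, E) x} {Λ : Set M}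
    {C : ℝ} (hC : 0 < C) (hle : ∀ x, distTo x (Sing V) ≤ C * ‖V x‖)
    (hR : RescalingExpansiveOn V Λ) : SingularExpansiveOn V Λ := by
  intro ε hε
  obtain ⟨δ, hδ, H⟩ := hR ε hε
  refine ⟨δ / C, by positivity, fun x hx y hy s hs hxy => ⟨0, ?_⟩⟩
  rw [zero_sub, zero_add]
  refine H x hx y hy s hs fun t => (hxy t).trans ?_
  calc δ / C * distTo (flow V t x) (Sing V) ≤ δ / C * (C * ‖V (flow V t x)‖) := by
        gcongr; exact hle _
    _ = δ * ‖V (flow V t x)‖ := by field_simp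

/-- A smooth Riemannian metric is continuous. -/
lemma isContinuousRiemannianBundle_of_contMDiff
    {E : Type*} [NormedAddCommGroup E] [NormedSpace ℝ E]
    {M : Type*} [MetricSpace M] [ChartedSpace E M] [IsManifold 𝓘(ℝ, E) ∞ M]
    [RiemannianBundle (fun x : M => TangentSpace 𝓘(ℝ, E) x)]
    [h : IsContMDiffRiemannianBundle 𝓘(ℝ, E) ∞ E (fun x : M => TangentSpace 𝓘(ℝ, E) x)] :
    IsContinuousRiemannianBundle E (fun x : M => TangentSpace 𝓘(ℝ, E) x) := by
  obtain ⟨g, hg, hg'⟩ := h.exists_contMDiff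
  exact ⟨g, hg.continuous, hg'⟩

end SingularFlow

theorem mainTheorem4
    {E : Type*} [NormedAddCommGroup E] [NormedSpace ℝ E] [FiniteDimensional ℝ E]
    {M : Type*} [MetricSpace M] [CompactSpace M] [ConnectedSpace M]
    [ChartedSpace E M] [IsManifold 𝓘(ℝ, E) ∞ M]
    [RiemannianBundle (fun x : M => TangentSpace 𝓘(ℝ, E) x)]
    [IsContMDiffRiemannianBundle 𝓘(ℝ, E) ∞ E (fun x : M => TangentSpace 𝓘(ℝ, E) x)]
    [IsRiemannianManifold 𝓘(ℝ, E) M]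
    (V : (x : M) → TangentSpace 𝓘(ℝ, E) x)
    (hV : ContMDiff 𝓘(ℝ, E) 𝓘(ℝ, E).tangent 1
      (fun x : M => (⟨x, V x⟩ : TangentBundle 𝓘(ℝ, E) M)))
    (hDV : ∀ σ ∈ SingularFlow.Sing V, Function.Bijective (SingularFlow.derivAt V σ))
    (Λ : Set M) :
    SingularFlow.SingularExpansiveOn V Λ ↔ SingularFlow.RescalingExpansiveOn V Λ := by
  have : CompleteSpace E := FiniteDimensional.complete ℝ E
  have : IsContinuousRiemannianBundle E (fun x : M => TangentSpace 𝓘(ℝ, E) x) :=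
    SingularFlow.isContinuousRiemannianBundle_of_contMDiff
  obtain ⟨C, hC, h⟩ := SingularFlow.exists_norm_comparable_distTo hV fun σ hσ => (hDV σ hσ).1
  exact ⟨fun hS => hS.rescalingExpansiveOn hV hC fun x => (h x).1,
    fun hR => hR.singularExpansiveOn hC fun x => (h x).2⟩
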